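/- Let $q$ denote a prime power and $\mathbb{F}_q$ the finite field with $q$ elements. For $S\subseteq\mathbb{F}_q^n$ and an integer $0\le k\le n$ put $E_k(S)=|S|/q^{n-k}$. A $k$-dimensional affine subspace $R$ of $\mathbb{F}_q^n$ is called $\tau$-balanced with respect to $S$ if $\bigl||R\cap S|-E_k(S)\bigr|\le\tau\,E_k(S)$, and a $k$-dimensional linear subspace $A$ of $\mathbb{F}_q^n$ is called $\tau$-shift-balanced with respect to $S$ if the translate $A+a$ is $\tau$-balanced with respect to $S$ for every $a\in\mathbb{F}_q^n$. **Theorem.** For every $\eta\in(0,1]$ there is a constant $C_\eta>0$, depending only on $\eta$, such that the following holds. Let $q$ be a prime power, $n\ge 5$ an integer, and $S\subseteq\mathbb{F}_q^n$ a set with $|S|>q^4$. Let $\tau>0$ and $\delta\in(0,1)$ be real numbers with $$q^{\eta}\ \ge\ C_\eta\,\max\left(\frac{n(1+\tau)}{(\tau\delta)^2},\,n\right).$$ Then for every integer $k\ge 0$ with $q^k|S|>q^{n+2+\eta}$, at least a $(1-\delta)$-fraction of all $k$-dimensional linear subspaces of $\mathbb{F}_q^n$ are $\tau$-shift-balanced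 with respect to $S$; that is, the number of $\tau$-shift-balanced $k$-dimensional linear subspaces is at least $(1-\delta)$ times the number of all $k$-dimensional linear subspaces. (For $k>n$ both numbers are $0$.) -/

import Mathlib

/-- The set of `k`-dimensional linear subspaces of `𝔽ⁿ`. -/
def linearSubspaces (F : Type*) [Field F] (n k : ℕ) : Set (Submodule F (Fin n → F)) :=
  {A | Module.finrank F A = k}

/-- `E_k(S) = |S| / q^(n-k)`, with `q = |F|`: the expected size of the intersection of `S` with a
uniformly random `k`-flat in `𝔽ⁿ`. -/
noncomputable def expectedInter {F : Type*} [Fintype F] {n : ℕ} (k : ℕ)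
    (S : Set (Fin n → F)) : ℝ :=
  (S.ncard : ℝ) / (Fintype.card F : ℝ) ^ ((n : ℤ) - (k : ℤ))

/-- A flat `R` of dimension `k` is `τ`-balanced with respect to `S` if
`| |R ∩ S| - E_k(S) | ≤ τ * E_k(S)`. -/
def IsBalanced {F : Type*} [Field F] [Fintype F] {n : ℕ} (τ : ℝ) (S : Set (Fin n → F))
    (R : AffineSubspace F (Fin n → F)) : Prop :=
  |(((R : Set (Fin n → F)) ∩ S).ncard : ℝ) - expectedInter (Module.finrank F R.direction) S| ≤
    τ * expectedInter (Module.finrank F R.direction) S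

/-- A linear subspace `A` is `τ`-shift-balanced with respect to `S` if every translate `A + a`
is `τ`-balanced with respect to `S`. -/
def IsShiftBalanced {F : Type*} [Field F] [Fintype F] {n : ℕ} (τ : ℝ) (S : Set (Fin n → F))
    (A : Submodule F (Fin n → F)) : Prop :=
  ∀ a : Fin n → F, IsBalanced τ S (AffineSubspace.mk' a A)

/-! The proof is the polynomial method with multiplicities, with signed weights on `S`. Give each
point the weight `1 + c·1_S`, where `c` is small and its sign is that of the deviation to be
excluded. By dimension counting (`exists_vanishesToOrder`) a nonzero `P` vanishes to order about `m`
times the weight at every point, with degree about `m q D`, where `D^n` bounds the mean of the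
`n`-th powers of the weights; to first order `D` is the mean weight (`weighted_pow_mean_le`). If a
flat `a + span b` deviates in the direction of `c`, the orders of vanishing along it sum to more
than the degree of `P` allows. By Schwartz-Zippel with multiplicities, `P` then vanishes to order
`r`, proportional to `m`, identically along the flat. Taking top-degree parts removes `a`: the top
form of `P`, viewed over `F[s]`, vanishes to order `r` at the generic direction `∑ s_l b_l`
(`vanishesToOrder_top_of_flat`). These generic directions lie in the grid `T^n`, with `T` the `q^k`
linear forms in `s`. A second use of Schwartz-Zippel, now over the domain `F[s]`, bounds the number
of tuples `b` (`card_directions_le`). As `a` may depend on `b`, all translates are treated at once.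
Dividing by the number of bases of a subspace gives the fraction of bad subspaces; the two signs of
`c` cost `δ/2` each. -/

namespace MvPolynomial

/-! ### Translations and the Schwartz-Zippel lemma with multiplicities. -/

/-- The polynomial `P(X + a)`, as an algebra homomorphism in `P`. -/
noncomputable def translate {σ R : Type*} [CommRing R] (a : σ → R) :
    MvPolynomial σ R →ₐ[R] MvPolynomial σ R :=
  aeval fun i => X i + C (a i)

/-- `P` vanishes at `a` to order at least `r`. -/
def VanishesToOrder {σ R : Type*} [CommRing R] (P : MvPolynomial σ R) (a : σ → R) (r : ℕ) : Prop :=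
  ∀ s : σ →₀ ℕ, s.degree < r → coeff s (translate a P) = 0

section translate
variable {σ R : Type*} [CommRing R]

@[simp] theorem translate_X (a : σ → R) (i : σ) : translate a (X i) = X i + C (a i) := by
  simp [translate]

@[simp] theorem translate_C (a : σ → R) (r : R) : translate a (C r) = C r := by
  simp [translate, algebraMap_eq]

theorem translate_translate (a b : σ → R) (P : MvPolynomial σ R) :
    translate a (translate b P) = translate (a + b) P := by
  have : (translate a).comp (translate b) = translate (a + b) := by
    ext i
    simp [add_assoc]
  exact DFunLike.congr_fun this P

theorem translate_zero (P : MvPolynomial σ R) : translate 0 P = P := by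
  have : translate (0 : σ → R) = AlgHom.id R _ := by
    ext i
    simp
  rw [this]; rfl

theorem translate_injective (a : σ → R) : Function.Injective (translate a) := by
  refine Function.LeftInverse.injective (g := translate (-a)) fun P => ?_
  rw [translate_translate, neg_add_cancel, translate_zero]

end translate

/-- Taylor coefficients at a point of the base ring are `R`-linear combinations of the coefficients,
so a linear functional passes through them. -/
theorem coeff_taylor_of_coeff_eq {R A : Type*} [CommRing R] [CommRing A] [Algebra R A]
    (φ : A →ₗ[R] R) (G : Polynomial A) (Q : Polynomial R) (h : ∀ j, Q.coeff j = φ (G.coeff j))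
    (b : R) (j : ℕ) :
    (Polynomial.taylor b Q).coeff j = φ ((Polynomial.taylor (algebraMap R A b) G).coeff j) := by
  have h1 := Polynomial.eval_eq_sum_range' (p := Polynomial.hasseDeriv j Q)
    (n := max (Polynomial.hasseDeriv j Q).natDegree (Polynomial.hasseDeriv j G).natDegree + 1)
    (by omega) b
  have h2 := Polynomial.eval_eq_sum_range' (p := Polynomial.hasseDeriv j G)
    (n := max (Polynomial.hasseDeriv j Q).natDegree (Polynomial.hasseDeriv j G).natDegree + 1)
    (by omega) (algebraMap R A b)
  rw [Polynomial.taylor_coeff, Polynomial.taylor_coeff, h1, h2, map_sum]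
  refine Finset.sum_congr rfl fun i _ => ?_
  have : (((i + j).choose j : ℕ) : A) * G.coeff (i + j) * algebraMap R A b ^ i =
      ((((i + j).choose j : ℕ) : R) * b ^ i) • G.coeff (i + j) := by
    rw [Algebra.smul_def]; simp; ring
  rw [Polynomial.hasseDeriv_coeff, Polynomial.hasseDeriv_coeff, this, map_smul, h, smul_eq_mul]
  ring

theorem finSuccEquiv_translate {R : Type*} [CommRing R] {n : ℕ} (b : R) (a : Fin n → R)
    (P : MvPolynomial (Fin (n + 1)) R) :
    finSuccEquiv R n (translate (Fin.cons b a) P) =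
      Polynomial.taylor (C b) ((finSuccEquiv R n P).map (translate a : _ →+* _)) := by
  have : ((finSuccEquiv R n : _ →ₐ[R] _).comp (translate (Fin.cons b a))) =
      (((Polynomial.taylorAlgHom (C b : MvPolynomial (Fin n) R)).restrictScalars R).comp
        (Polynomial.mapAlgHom (translate a))).comp (finSuccEquiv R n : _ →ₐ[R] _) := by
    apply algHom_ext
    intro i
    refine Fin.cases ?_ (fun i => ?_) i
    · simp [finSuccEquiv_apply]
    · simp [finSuccEquiv_apply]
  exact DFunLike.congr_fun this P

/-- The Schwartz-Zippel lemma with multiplicities. -/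
theorem card_mul_sum_vanishing_order_le {R : Type*} [CommRing R] [IsDomain R] [DecidableEq R]
    (T : Finset R) : ∀ (n : ℕ) (P : MvPolynomial (Fin n) R), P ≠ 0 →
      ∀ M : (Fin n → R) → ℕ,
      (∀ a ∈ Fintype.piFinset fun _ : Fin n => T, P.VanishesToOrder a (M a)) →
      T.card * ∑ a ∈ Fintype.piFinset (fun _ : Fin n => T), M a ≤ P.totalDegree * T.card ^ n
  | 0, P, hP, M, hM => by
    have h0 : ∀ a ∈ Fintype.piFinset fun _ : Fin 0 => T, M a = 0 := by
      intro a ha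
      by_contra hne
      have h1 := hM a ha 0 (by simpa using Nat.pos_of_ne_zero hne)
      apply hP
      apply translate_injective a
      rw [map_zero]
      ext s
      rw [Subsingleton.elim s 0, h1]; simp
    rw [Finset.sum_eq_zero h0]; simp
  | n + 1, P, hP, M, hM => by
    set G := finSuccEquiv R n P with hG
    have hG0 : G ≠ 0 := by simpa [hG] using hP
    set t := G.natDegree
    set L := G.coeff t with hL
    have hL0 : L ≠ 0 := by simpa [hL, t] using hG0
    have hdeg : L.totalDegree + t ≤ P.totalDegree :=
      totalDegree_coeff_finSuccEquiv_add_le P t hL0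
    -- For each `a`, pick a monomial of least degree in the expansion of the leading coefficient `L`
    -- at `a`. The induction hypothesis for `L` bounds the sum of these degrees.
    have key : ∀ a : Fin n → R, ∃ s : Fin n →₀ ℕ, coeff s (translate a L) ≠ 0 ∧
        L.VanishesToOrder a s.degree := by
      intro a
      have hne : translate a L ≠ 0 := fun h => hL0 (translate_injective a (by rw [h, map_zero]))
      obtain ⟨s, hs⟩ := ne_zero_iff.1 hne
      classical
      have hex : ∃ r, ∃ s : Fin n →₀ ℕ, s.degree = r ∧ coeff s (translate a L) ≠ 0 :=
        ⟨_, s, rfl, hs⟩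
      obtain ⟨s', hs', hs'2⟩ := Nat.find_spec hex
      refine ⟨s', hs'2, fun u hu => ?_⟩
      by_contra hne'
      exact Nat.find_min hex (hs' ▸ hu) ⟨u, rfl, hne'⟩
    choose s hs hvan using key
    have ih := card_mul_sum_vanishing_order_le T n L hL0 (fun a => (s a).degree)
      (fun a _ => hvan a)
    have hfib : ∀ a ∈ Fintype.piFinset (fun _ : Fin n => T),
        ∑ b ∈ T, M (Fin.cons b a) ≤ t + T.card * (s a).degree := by
      intro a ha
      let φ : MvPolynomial (Fin n) R →ₗ[R] R := (lcoeff R (s a)) ∘ₗ (translate a).toLinearMap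
      -- `Q` is the coefficient of the monomial `s a` in `P` expanded at `a` in the last `n`
      -- variables. The choice of `s a` keeps its `X^t` coefficient nonzero, and each `b` is a root
      -- of order at least `M (b, a) - |s a|`.
      let Q : Polynomial R := ∑ j ∈ Finset.range (t + 1), Polynomial.monomial j (φ (G.coeff j))
      have hQ : ∀ j, Q.coeff j = φ (G.coeff j) := by
        intro j
        simp only [Q, Polynomial.finsetSum_coeff, Polynomial.coeff_monomial,
          Finset.sum_ite_eq', Finset.mem_range]
        split_ifs with h
        · rfl
        · rw [Polynomial.coeff_eq_zero_of_natDegree_lt (show t < j by omega), map_zero]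
      have hQ0 : Q ≠ 0 := by
        intro h
        have := hQ t
        rw [h, Polynomial.coeff_zero] at this
        exact hs a this.symm
      have hQd : Q.natDegree ≤ t := by
        rw [Polynomial.natDegree_le_iff_coeff_eq_zero]
        intro j hj
        rw [hQ, Polynomial.coeff_eq_zero_of_natDegree_lt hj, map_zero]
      have hroot : ∀ b ∈ T, M (Fin.cons b a) ≤ Q.rootMultiplicity b + (s a).degree := by
        intro b hb
        rw [← tsub_le_iff_right, Polynomial.le_rootMultiplicity_iff hQ0]
        have hmem : (Fin.cons b a : Fin (n + 1) → R) ∈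
            Fintype.piFinset fun _ : Fin (n + 1) => T := by
          rw [Fintype.mem_piFinset] at ha ⊢
          exact fun i => Fin.cases hb ha i
        have hX : Polynomial.X ^ (M (Fin.cons b a) - (s a).degree) ∣ Polynomial.taylor b Q := by
          rw [Polynomial.X_pow_dvd_iff]
          intro j hj
          have h1 := hM _ hmem (Finsupp.cons j (s a)) (by
            have : (Finsupp.cons j (s a)).degree = j + (s a).degree := by
              simp [Finsupp.degree_eq_sum, Fin.sum_univ_succ]
            omega)
          rw [← finSuccEquiv_coeff_coeff, finSuccEquiv_translate] at h1
          let ψ : MvPolynomial (Fin n) R →ₗ[R] R := lcoeff R (s a)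
          rw [coeff_taylor_of_coeff_eq ψ (G.map (translate a : _ →+* _)) Q (by
            intro j; rw [hQ, Polynomial.coeff_map]; rfl)]
          exact h1
        have h2 := map_dvd (Polynomial.taylorAlgHom (-b)) hX
        rw [map_pow] at h2
        simpa [Polynomial.taylor_taylor, sub_eq_add_neg] using h2
      calc ∑ b ∈ T, M (Fin.cons b a) ≤ ∑ b ∈ T, (Q.rootMultiplicity b + (s a).degree) :=
            Finset.sum_le_sum hroot
        _ = ∑ b ∈ T, Q.roots.count b + T.card * (s a).degree := by
            simp [Finset.sum_add_distrib]
        _ ≤ t + T.card * (s a).degree := by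
            gcongr
            calc ∑ b ∈ T, Q.roots.count b ≤ Q.roots.card := by
                  rw [← Multiset.sum_count_eq_card (s := T ∪ Q.roots.toFinset)
                    fun b hb => Finset.mem_union_right _ (Multiset.mem_toFinset.2 hb)]
                  exact Finset.sum_le_sum_of_subset Finset.subset_union_left
              _ ≤ Q.natDegree := Q.card_roots'
              _ ≤ t := hQd
    have hsplit : ∑ a ∈ Fintype.piFinset (fun _ : Fin (n + 1) => T), M a =
        ∑ a ∈ Fintype.piFinset (fun _ : Fin n => T), ∑ b ∈ T, M (Fin.cons b a) := by
      rw [← Finset.sum_product']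
      refine Finset.sum_nbij' (fun a => (Fin.tail a, a 0)) (fun p => Fin.cons p.2 p.1) ?_ ?_ ?_ ?_ ?_
      · intro a ha
        simp only [Fintype.mem_piFinset, Finset.mem_product] at ha ⊢
        exact ⟨fun i => ha i.succ, ha 0⟩
      · intro p hp
        simp only [Fintype.mem_piFinset, Finset.mem_product] at hp ⊢
        exact fun i => Fin.cases hp.2 hp.1 i
      · intro a _; simp
      · intro p _; simp
      · intro a _; simp
    calc T.card * ∑ a ∈ Fintype.piFinset (fun _ : Fin (n + 1) => T), M a
        ≤ T.card * ∑ a ∈ Fintype.piFinset (fun _ : Fin n => T), (t + T.card * (s a).degree) := by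
          rw [hsplit]; exact Nat.mul_le_mul_left _ (Finset.sum_le_sum hfib)
      _ = T.card * (t * T.card ^ n +
            T.card * ∑ a ∈ Fintype.piFinset (fun _ : Fin n => T), (s a).degree) := by
          rw [Finset.sum_add_distrib, ← Finset.mul_sum]; simp [mul_comm]
      _ ≤ T.card * (t * T.card ^ n + L.totalDegree * T.card ^ n) := by gcongr
      _ = (L.totalDegree + t) * T.card ^ (n + 1) := by ring
      _ ≤ P.totalDegree * T.card ^ (n + 1) := by gcongr

end MvPolynomial

/-! ### Interpolation by counting coefficients against vanishing conditions. -/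

namespace MvPolynomial

/-- The exponents of the monomials in `n` variables of degree less than `r`. -/
noncomputable def exponentsBelow (n r : ℕ) : Finset (Fin n →₀ ℕ) :=
  (Finset.range r).biUnion fun e => Finset.finsuppAntidiag Finset.univ e

theorem mem_exponentsBelow {n r : ℕ} {s : Fin n →₀ ℕ} : s ∈ exponentsBelow n r ↔ s.degree < r := by
  simp [exponentsBelow, Finset.mem_finsuppAntidiag, Finsupp.degree_eq_sum]

theorem card_exponentsBelow (n r : ℕ) : (exponentsBelow (n + 1) r).card = (n + r).choose (n + 1) := by
  rw [exponentsBelow, Finset.card_biUnion]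
  · simp only [Finset.card_finsuppAntidiag_nat_eq_choose, Finset.card_univ, Fintype.card_fin]
    induction r with
    | zero => simp
    | succ r ih =>
      rw [Finset.sum_range_succ, ih, ← add_assoc, Nat.choose_succ_succ, add_comm,
        show n + 1 + r - 1 = n + r by omega, Nat.choose_symm_add]
  · intro x _ y _ hxy
    rw [Function.onFun, Finset.disjoint_left]
    intro s hs hs'
    rw [Finset.mem_finsuppAntidiag] at hs hs'
    exact hxy (hs.1.symm.trans hs'.1)

theorem factorial_mul_card_exponentsBelow_le (n r : ℕ) :
    (n + 1).factorial * (exponentsBelow (n + 1) r).card ≤ (r + n) ^ (n + 1) := by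
  rw [card_exponentsBelow, ← Nat.descFactorial_eq_factorial_mul_choose, add_comm r]
  exact Nat.descFactorial_le_pow _ _

theorem pow_le_factorial_mul_card_exponentsBelow (n r : ℕ) :
    r ^ (n + 1) ≤ (n + 1).factorial * (exponentsBelow (n + 1) r).card := by
  rw [card_exponentsBelow, ← Nat.descFactorial_eq_factorial_mul_choose]
  have := Nat.pow_sub_le_descFactorial (n + r) (n + 1)
  rwa [show n + r + 1 - (n + 1) = r by omega] at this

/-- Interpolation: a nonzero polynomial of bounded degree with prescribed orders of vanishing. -/
theorem exists_vanishesToOrder {F : Type*} [Field F] [Fintype F] {n : ℕ} (hn : 1 ≤ n) (d : ℕ)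
    (M : (Fin n → F) → ℕ) (h : ∑ y, (M y + (n - 1)) ^ n ≤ d ^ n) :
    ∃ P : MvPolynomial (Fin n) F, P ≠ 0 ∧ P.totalDegree ≤ d ∧
      ∀ y, P.VanishesToOrder y (M y) := by
  obtain ⟨n, rfl⟩ : ∃ n', n = n' + 1 := ⟨n - 1, by omega⟩
  rw [Nat.add_sub_cancel] at h
  classical
  let poly : (exponentsBelow (n + 1) (d + 1) → F) →ₗ[F] MvPolynomial (Fin (n + 1)) F :=
    ∑ s : exponentsBelow (n + 1) (d + 1), (monomial s.1) ∘ₗ (LinearMap.proj s)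
  have hcoeff : ∀ c (s : exponentsBelow (n + 1) (d + 1)), coeff s.1 (poly c) = c s := by
    intro c s
    simp [poly, coeff_sum, coeff_monomial]
  let f : (exponentsBelow (n + 1) (d + 1) → F) →ₗ[F]
      ((Σ y : Fin (n + 1) → F, exponentsBelow (n + 1) (M y)) → F) :=
    LinearMap.pi fun p => (lcoeff F p.2.1) ∘ₗ (translate p.1).toLinearMap ∘ₗ poly
  have hker : LinearMap.ker f ≠ ⊥ := by
    apply LinearMap.ker_ne_bot_of_finrank_lt
    rw [Module.finrank_fintype_fun_eq_card, Module.finrank_fintype_fun_eq_card,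
      Fintype.card_sigma, Fintype.card_coe]
    simp only [Fintype.card_coe]
    refine lt_of_mul_lt_mul_left (a := (n + 1).factorial) ?_ (Nat.zero_le _)
    calc (n + 1).factorial * ∑ y, (exponentsBelow (n + 1) (M y)).card
        = ∑ y, (n + 1).factorial * (exponentsBelow (n + 1) (M y)).card := Finset.mul_sum _ _ _
      _ ≤ ∑ y, (M y + n) ^ (n + 1) :=
          Finset.sum_le_sum fun y _ => factorial_mul_card_exponentsBelow_le n (M y)
      _ ≤ d ^ (n + 1) := h
      -- Degree at most `d` means exponents below `d + 1`; this extra one makes the count of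
      -- unknowns strictly larger.
      _ < (d + 1) ^ (n + 1) := Nat.pow_lt_pow_left (Nat.lt_succ_self d) (Nat.succ_ne_zero n)
      _ ≤ _ := pow_le_factorial_mul_card_exponentsBelow n (d + 1)
  obtain ⟨c, hc, hc0⟩ := Submodule.exists_mem_ne_zero_of_ne_bot hker
  refine ⟨poly c, fun h0 => hc0 ?_, ?_, fun y s hs => ?_⟩
  · ext s
    have := hcoeff c s
    rw [h0, coeff_zero] at this
    simpa using this.symm
  · refine (mem_restrictTotalDegree (Fin (n + 1)) d _).1 ?_
    simp only [poly, LinearMap.sum_apply]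
    refine Submodule.sum_mem _ fun s _ => ?_
    rw [mem_restrictTotalDegree]
    refine (totalDegree_monomial_le _ _).trans ?_
    have := mem_exponentsBelow.1 s.2
    rw [Finsupp.degree_apply] at this
    exact Nat.lt_succ_iff.1 this
  · exact congrFun (LinearMap.mem_ker.1 hc) ⟨y, s, mem_exponentsBelow.2 hs⟩

end MvPolynomial

/-! ### Expansion along flats and the passage to the top form. -/

namespace MvPolynomial

section fiber
variable {F : Type*} [Field F] {n k : ℕ}

/-- The linear form with coefficients `c`. -/
noncomputable def linForm (c : Fin k → F) : MvPolynomial (Fin k) F := ∑ l, C (c l) * X l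

theorem isHomogeneous_linForm (c : Fin k → F) : (linForm c).IsHomogeneous 1 :=
  IsHomogeneous.sum _ _ _ fun l _ => isHomogeneous_C_mul_X (c l) l

theorem linForm_injective : Function.Injective (linForm : (Fin k → F) → MvPolynomial (Fin k) F) := by
  intro c c' h
  ext l
  have := congrArg (coeff (Finsupp.single l 1)) h
  simpa [linForm, coeff_sum, coeff_C_mul, coeff_X, Finsupp.single_left_inj] using this

/-- The polynomial `P(Y + ∑ l, s l • b l)` in `Y`, with coefficients polynomials in `s`. -/
noncomputable def fiberExpansion (b : Fin k → Fin n → F) :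
    MvPolynomial (Fin n) F →+* MvPolynomial (Fin n) (MvPolynomial (Fin k) F) :=
  (translate fun i => linForm fun l => b l i : _ →ₐ[MvPolynomial (Fin k) F] _).toRingHom.comp
    (map C)

theorem fiberExpansion_C (b : Fin k → Fin n → F) (c : F) :
    fiberExpansion b (C c) = C (C c) := by
  simp [fiberExpansion]

theorem fiberExpansion_X (b : Fin k → Fin n → F) (i : Fin n) :
    fiberExpansion b (X i) = X i + C (linForm fun l => b l i) := by
  simp [fiberExpansion]

/-- Moving the parameter `s` moves the base point inside the flat, so vanishing of `P` at a point of
the flat becomes vanishing in `s` of the coefficients of the expansion. -/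
theorem map_translate_fiberExpansion (b : Fin k → Fin n → F) (s : Fin k → F)
    (P : MvPolynomial (Fin n) F) :
    map (translate s : _ →+* _) (fiberExpansion b P) =
      fiberExpansion b (translate (∑ l, s l • b l) P) := by
  have : (map (translate s : MvPolynomial (Fin k) F →+* _)).comp (fiberExpansion b) =
      (fiberExpansion b).comp (translate (∑ l, s l • b l) : _ →+* _) := by
    apply ringHom_ext
    · intro c
      simp [fiberExpansion_C]
    · intro i
      simp [fiberExpansion_C, fiberExpansion_X, linForm, mul_add, Finset.sum_add_distrib, add_assoc,
        mul_comm]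
  exact DFunLike.congr_fun this P

theorem map_eval_fiberExpansion (b : Fin k → Fin n → F) (s : Fin k → F)
    (P : MvPolynomial (Fin n) F) :
    map (eval s) (fiberExpansion b P) = translate (∑ l, s l • b l) P := by
  have : (map (eval s)).comp (fiberExpansion b) =
      (translate (∑ l, s l • b l) : _ →+* _) := by
    apply ringHom_ext
    · intro c
      simp [fiberExpansion_C]
    · intro i
      simp [fiberExpansion_X, linForm, mul_comm]
  exact DFunLike.congr_fun this P

/-- `W` is homogeneous of degree `e` in both groups of variables together. -/
def IsJointlyHomogeneous (W : MvPolynomial (Fin n) (MvPolynomial (Fin k) F)) (e : ℕ) : Prop :=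
  ∀ i t, coeff t (coeff i W) ≠ 0 → i.degree + t.degree = e

theorem IsJointlyHomogeneous.mul {W V : MvPolynomial (Fin n) (MvPolynomial (Fin k) F)} {e f : ℕ}
    (hW : W.IsJointlyHomogeneous e) (hV : V.IsJointlyHomogeneous f) :
    (W * V).IsJointlyHomogeneous (e + f) := by
  classical
  intro i t h
  rw [coeff_mul, coeff_sum] at h
  obtain ⟨p, hp, h⟩ := Finset.exists_ne_zero_of_sum_ne_zero h
  rw [coeff_mul] at h
  obtain ⟨r, hr, h⟩ := Finset.exists_ne_zero_of_sum_ne_zero h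
  rw [Finset.HasAntidiagonal.mem_antidiagonal] at hp hr
  have h1 := hW _ _ (left_ne_zero_of_mul h)
  have h2 := hV _ _ (right_ne_zero_of_mul h)
  rw [← hp, ← hr, map_add, map_add]
  omega

theorem isJointlyHomogeneous_C_C (c : F) :
    (C (C c) : MvPolynomial (Fin n) (MvPolynomial (Fin k) F)).IsJointlyHomogeneous 0 := by
  classical
  intro i t h
  rw [coeff_C] at h
  split_ifs at h with h1
  · rw [coeff_C] at h
    split_ifs at h with h2
    · simp [← h1, ← h2]
    · exact absurd rfl h
  · simp at h

theorem IsJointlyHomogeneous.pow {W : MvPolynomial (Fin n) (MvPolynomial (Fin k) F)} {e : ℕ}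
    (hW : W.IsJointlyHomogeneous e) (r : ℕ) : (W ^ r).IsJointlyHomogeneous (r * e) := by
  induction r with
  | zero => simpa using isJointlyHomogeneous_C_C (n := n) (k := k) (1 : F)
  | succ r ih => rw [pow_succ, add_mul, one_mul]; exact ih.mul hW

theorem isJointlyHomogeneous_fiberExpansion_X (b : Fin k → Fin n → F) (j : Fin n) :
    (fiberExpansion b (X j)).IsJointlyHomogeneous 1 := by
  classical
  intro i t h
  rw [fiberExpansion_X, coeff_add, coeff_X, coeff_C] at h
  by_cases h1 : Finsupp.single j 1 = i
  · have h2 : i ≠ 0 := by rw [← h1]; simp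
    rw [if_pos h1, if_neg h2.symm, add_zero, coeff_one] at h
    split_ifs at h with h3
    · simp [← h1, ← h3]
    · exact absurd rfl h
  · rw [if_neg h1, zero_add] at h
    split_ifs at h with h2
    · rw [← h2, map_zero, zero_add]
      by_contra h3
      exact h ((isHomogeneous_linForm _).coeff_eq_zero h3)
    · simp at h

theorem isJointlyHomogeneous_fiberExpansion_monomial (b : Fin k → Fin n → F) (s : Fin n →₀ ℕ)
    (c : F) : (fiberExpansion b (monomial s c)).IsJointlyHomogeneous s.degree := by
  rw [monomial_eq, Finsupp.prod_fintype _ _ (by simp), map_mul, map_prod, fiberExpansion_C,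
    ← zero_add s.degree, Finsupp.degree_eq_sum]
  refine (isJointlyHomogeneous_C_C c).mul ?_
  generalize (Finset.univ : Finset (Fin n)) = u
  classical
  induction u using Finset.induction_on with
  | empty => simpa using isJointlyHomogeneous_C_C (n := n) (k := k) (1 : F)
  | insert j u hj ih =>
    rw [Finset.prod_insert hj, Finset.sum_insert hj, map_pow]
    have := (isJointlyHomogeneous_fiberExpansion_X b j).pow (s j)
    rw [mul_one] at this
    exact this.mul ih

theorem isJointlyHomogeneous_fiberExpansion (b : Fin k → Fin n → F) {P : MvPolynomial (Fin n) F}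
    {e : ℕ} (hP : P.IsHomogeneous e) : (fiberExpansion b P).IsJointlyHomogeneous e := by
  intro i t h
  rw [P.as_sum, map_sum, coeff_sum, coeff_sum] at h
  obtain ⟨s, hs, h⟩ := Finset.exists_ne_zero_of_sum_ne_zero h
  rw [isJointlyHomogeneous_fiberExpansion_monomial b s _ i t h]
  by_contra hne
  exact mem_support_iff.1 hs (hP.coeff_eq_zero hne)

/-- Joint homogeneity: the coefficient of `Y^i s^t` sees only the part of `P` of degree `|i| + |t|`.
Degree bounds, orders of vanishing and the isolation of the top form all rest on this. -/
theorem coeff_coeff_fiberExpansion (b : Fin k → Fin n → F) (P : MvPolynomial (Fin n) F)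
    (i : Fin n →₀ ℕ) (t : Fin k →₀ ℕ) :
    coeff t (coeff i (fiberExpansion b P)) =
      coeff t (coeff i (fiberExpansion b (homogeneousComponent (i.degree + t.degree) P))) := by
  conv_lhs => rw [← sum_homogeneousComponent P, map_sum, coeff_sum, coeff_sum]
  refine Finset.sum_eq_single _ (fun e _ he => ?_) (fun h => ?_)
  · by_contra hne
    exact he (isJointlyHomogeneous_fiberExpansion b
      (homogeneousComponent_isHomogeneous e P) i t hne).symm
  · rw [homogeneousComponent_eq_zero _ _ (by simpa using h)]; simp

theorem homogeneousComponent_eq_zero_of_vanishesToOrder_zero {P : MvPolynomial (Fin n) F}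
    {r e : ℕ} (h : ∀ s : Fin n →₀ ℕ, s.degree < r → coeff s P = 0) (he : e < r) :
    homogeneousComponent e P = 0 := by
  ext s
  rw [coeff_homogeneousComponent, coeff_zero]
  split_ifs with hs
  · exact h s (hs ▸ he)
  · rfl

/-- Translation does not change the top form. -/
theorem homogeneousComponent_translate (a : Fin n → F) {P : MvPolynomial (Fin n) F} {d : ℕ}
    (hd : P.totalDegree ≤ d) :
    homogeneousComponent d (translate a P) = homogeneousComponent d P := by
  ext i
  rw [coeff_homogeneousComponent, coeff_homogeneousComponent]
  split_ifs with hi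
  · let b : Fin 1 → Fin n → F := fun _ => a
    -- In `P(Y + s a)` a monomial `Y^i` with `|i| = d` leaves no degree for `s`, so the values `s =
    -- 1` and `s = 0` give the same coefficient.
    have hconst : coeff i (fiberExpansion b P) = C (coeff 0 (coeff i (fiberExpansion b P))) := by
      classical
      ext t
      rw [coeff_C]
      split_ifs with ht
      · rw [ht]
      · rw [coeff_coeff_fiberExpansion, homogeneousComponent_eq_zero]
        · simp
        · have : 0 < t.degree := Nat.pos_of_ne_zero fun h =>
            ht ((Finsupp.degree_eq_zero_iff _).1 h).symm
          omega
    have h1 := map_eval_fiberExpansion b (fun _ => 1) P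
    have h2 := map_eval_fiberExpansion b (fun _ => 0) P
    simp only [zero_smul, Finset.sum_const_zero, translate_zero] at h2
    simp only [one_smul, Finset.univ_unique, Finset.sum_const, Finset.card_singleton, b] at h1
    rw [← h1, coeff_map]
    conv_rhs => rw [← h2, coeff_map]
    change eval _ (coeff i (fiberExpansion b P)) = eval _ (coeff i (fiberExpansion b P))
    rw [hconst]; simp
  · rfl

theorem totalDegree_translate_le (a : Fin n → F) (P : MvPolynomial (Fin n) F) :
    (translate a P).totalDegree ≤ P.totalDegree := by
  rw [totalDegree, Finset.sup_le_iff]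
  intro s hs
  by_contra! hlt
  have h1 := homogeneousComponent_translate a (P := P) hlt.le
  rw [homogeneousComponent_eq_zero _ _ hlt] at h1
  have h2 := congrArg (coeff s) h1
  rw [coeff_homogeneousComponent, if_pos (by rw [Finsupp.degree_apply]; rfl)] at h2
  exact mem_support_iff.1 hs (by simpa using h2)

theorem totalDegree_coeff_fiberExpansion_le (b : Fin k → Fin n → F) (P : MvPolynomial (Fin n) F)
    (i : Fin n →₀ ℕ) : (coeff i (fiberExpansion b P)).totalDegree ≤ P.totalDegree := by
  rw [totalDegree, Finset.sup_le_iff]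
  intro t ht
  by_contra! hlt
  rw [mem_support_iff, coeff_coeff_fiberExpansion, homogeneousComponent_eq_zero] at ht
  · simp at ht
  · refine lt_of_lt_of_le hlt (le_trans (le_of_eq ?_) (Nat.le_add_left _ _))
    rw [Finsupp.degree_apply]; rfl

variable [Fintype F]

/-- If `P` vanishes to high order on the flat `a + span b`, then its top form, over the ring of
polynomials in `s`, vanishes to high order at the generic vector `∑ l, s l • b l`. -/
theorem vanishesToOrder_top_of_flat {P : MvPolynomial (Fin n) F} {M : (Fin n → F) → ℕ}
    (hM : ∀ y, P.VanishesToOrder y (M y)) (a : Fin n → F) (b : Fin k → Fin n → F) (r : ℕ)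
    (h : P.totalDegree * Fintype.card F ^ k + r * Fintype.card F ^ (k + 1) <
      Fintype.card F * ∑ s : Fin k → F, M (a + ∑ l, s l • b l)) :
    (map C (homogeneousComponent P.totalDegree P) :
      MvPolynomial (Fin n) (MvPolynomial (Fin k) F)).VanishesToOrder
        (fun i => linForm fun l => b l i) r := by
  classical
  have hQ : ∀ i : Fin n →₀ ℕ, i.degree < r → coeff i (fiberExpansion b (translate a P)) = 0 := by
    intro i hi
    by_contra hne
    -- Passing to the coefficient of `Y^i` costs `|i|` in the order of vanishing, and `|i| < r`; the
    -- term with `r` in `h` pays for this.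
    have hvan : ∀ s ∈ Fintype.piFinset fun _ : Fin k => (Finset.univ : Finset F),
        (coeff i (fiberExpansion b (translate a P))).VanishesToOrder s
          (M (a + ∑ l, s l • b l) - i.degree) := by
      intro s _ t ht
      have h1 := congrArg (coeff i) (map_translate_fiberExpansion b s (translate a P))
      rw [coeff_map] at h1
      change coeff t ((translate s : MvPolynomial (Fin k) F →+* MvPolynomial (Fin k) F)
        (coeff i (fiberExpansion b (translate a P)))) = 0
      rw [h1, translate_translate, coeff_coeff_fiberExpansion,
        homogeneousComponent_eq_zero_of_vanishesToOrder_zero (r := M (a + ∑ l, s l • b l))]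
      · simp
      · rw [add_comm]; exact hM _
      · omega
    have hsz := card_mul_sum_vanishing_order_le Finset.univ k _ hne _ hvan
    rw [Fintype.piFinset_univ, Finset.card_univ] at hsz
    have h2 : ∑ s : Fin k → F, M (a + ∑ l, s l • b l) ≤
        ∑ s : Fin k → F, (M (a + ∑ l, s l • b l) - i.degree) + r * Fintype.card F ^ k := by
      calc ∑ s : Fin k → F, M (a + ∑ l, s l • b l)
          ≤ ∑ s : Fin k → F, ((M (a + ∑ l, s l • b l) - i.degree) + r) :=
            Finset.sum_le_sum fun s _ => by omega
        _ = _ := by simp [Finset.sum_add_distrib, mul_comm]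
    have h3 : (coeff i (fiberExpansion b (translate a P))).totalDegree ≤ P.totalDegree :=
      (totalDegree_coeff_fiberExpansion_le _ _ _).trans (totalDegree_translate_le _ _)
    have h4 := Nat.mul_le_mul_left (Fintype.card F) h2
    have h5 := Nat.mul_le_mul_right (Fintype.card F ^ k) h3
    have h6 : r * Fintype.card F ^ (k + 1) = Fintype.card F * (r * Fintype.card F ^ k) := by ring
    rw [mul_add] at h4
    omega
  -- In the top form, `Y^i s^t` occurs only for `|i| + |t|` equal to the degree of `P`, and there
  -- its coefficient agrees with that of the translated `P`, already shown to vanish.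
  intro i hi
  change coeff i (fiberExpansion b (homogeneousComponent P.totalDegree P)) = 0
  ext t
  rw [coeff_zero]
  by_contra hne
  have hdeg := isJointlyHomogeneous_fiberExpansion b
    (homogeneousComponent_isHomogeneous _ P) i t hne
  have h1 := coeff_coeff_fiberExpansion b (translate a P) i t
  rw [hQ i hi, hdeg, homogeneousComponent_translate a le_rfl] at h1
  exact hne (by simpa using h1.symm)

/-- Few tuples of directions span flats on which `P` vanishes to high order. -/
theorem card_directions_le {P : MvPolynomial (Fin n) F} (hP : P ≠ 0) {M : (Fin n → F) → ℕ}
    (hM : ∀ y, P.VanishesToOrder y (M y)) (r : ℕ) (B : Finset (Fin k → Fin n → F))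
    (h : ∀ b ∈ B, ∃ a, P.totalDegree * Fintype.card F ^ k + r * Fintype.card F ^ (k + 1) <
      Fintype.card F * ∑ s : Fin k → F, M (a + ∑ l, s l • b l)) :
    Fintype.card F ^ k * (r * B.card) ≤ P.totalDegree * (Fintype.card F ^ k) ^ n := by
  classical
  let pt : (Fin k → Fin n → F) → Fin n → MvPolynomial (Fin k) F :=
    fun b i => linForm fun l => b l i
  have hpt : Function.Injective pt := by
    intro b b' hbb
    ext l i
    exact congrFun (linForm_injective (congrFun hbb i)) l
  let T : Finset (MvPolynomial (Fin k) F) := Finset.univ.image linForm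
  have hT : T.card = Fintype.card F ^ k := by
    rw [Finset.card_image_of_injective _ linForm_injective]; simp
  let H : MvPolynomial (Fin n) (MvPolynomial (Fin k) F) :=
    map C (homogeneousComponent P.totalDegree P)
  have hH0 : H ≠ 0 := by
    intro h0
    have h1 : homogeneousComponent P.totalDegree P = 0 :=
      map_injective _ (C_injective _ _) (by rw [map_zero]; exact h0)
    obtain ⟨s, hs, hs'⟩ := Finset.exists_mem_eq_sup P.support
      (support_nonempty.2 hP) fun s => s.sum fun _ e => e
    have h2 := congrArg (coeff s) h1
    rw [coeff_homogeneousComponent, if_pos (by rw [Finsupp.degree_apply]; exact hs'.symm)] at h2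
    exact mem_support_iff.1 hs (by simpa using h2)
  have hHd : H.totalDegree ≤ P.totalDegree :=
    ((homogeneousComponent_isHomogeneous _ P).map C).totalDegree_le
  have hsz := card_mul_sum_vanishing_order_le T n H hH0
    (fun x => if x ∈ B.image pt then r else 0) (by
      intro x _
      split_ifs with hx
      · obtain ⟨b, hb, rfl⟩ := Finset.mem_image.1 hx
        obtain ⟨a, ha⟩ := h b hb
        exact vanishesToOrder_top_of_flat hM a b r ha
      · exact fun s hs => absurd hs (Nat.not_lt_zero _))
  have hsub : B.image pt ⊆ Fintype.piFinset fun _ : Fin n => T := by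
    intro x hx
    obtain ⟨b, hb, rfl⟩ := Finset.mem_image.1 hx
    exact Fintype.mem_piFinset.2 fun i => Finset.mem_image_of_mem _ (Finset.mem_univ _)
  rw [Finset.sum_ite_mem, Finset.inter_eq_right.2 hsub, Finset.sum_const,
    Finset.card_image_of_injective _ hpt, smul_eq_mul, hT, mul_comm _ r] at hsz
  exact hsz.trans (Nat.mul_le_mul_right _ hHd)

end fiber

end MvPolynomial

/-! ### Choice of weights and the bound on deviating tuples. -/

theorem one_add_pow_le_of_abs_le {n : ℕ} {y : ℝ} (h : |n * y| ≤ 1) (hy : 0 ≤ 1 + y) :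
    (1 + y) ^ n ≤ 1 + n * y + (n * y) ^ 2 := by
  have h1 : (1 + y) ^ n ≤ Real.exp (n * y) := by
    rw [Real.exp_nat_mul]
    exact pow_le_pow_left₀ hy (by linarith [Real.add_one_le_exp y]) n
  have h2 := (abs_le.1 (Real.abs_exp_sub_one_sub_id_le h)).2
  linarith

/-- Here `e` is the density of `S` and `θ` the rounding error. Expand the left side to second order
and bound the right side below by Bernoulli; the terms in `θ` total at most `(1 + 1 + 1/2) n θ`,
whence `3 * θ`. -/
theorem weighted_pow_mean_le {n : ℕ} {e c θ : ℝ} (he : 0 ≤ e) (he1 : e ≤ 1)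
    (hc : n * |c| ≤ 1 / 2) (hθ : 0 ≤ θ) (hnθ : n * θ ≤ 1 / 2) (hn : 1 ≤ n) :
    e * (1 + c + θ) ^ n + (1 - e) * (1 + θ) ^ n ≤ (1 + e * (c + n * c ^ 2) + 3 * θ) ^ n := by
  have hn' : (1 : ℝ) ≤ n := by exact_mod_cast hn
  have hcn : |n * c| ≤ 1 / 2 := by rwa [abs_mul, Nat.abs_cast]
  obtain ⟨h1, h2⟩ := abs_le.1 hcn
  have hc1 : |c| ≤ 1 / 2 := le_trans (le_mul_of_one_le_left (abs_nonneg c) hn') hc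
  obtain ⟨h3, h4⟩ := abs_le.1 hc1
  have hnθ0 : 0 ≤ n * θ := by positivity
  have hA := one_add_pow_le_of_abs_le (n := n) (y := c + θ)
    (by rw [abs_le]; constructor <;> linarith) (by linarith)
  have hB := one_add_pow_le_of_abs_le (n := n) (y := θ)
    (by rw [abs_le]; constructor <;> linarith) (by linarith)
  have hcc : 0 ≤ n * c ^ 2 := by positivity
  have hec : -(1 / 2) ≤ e * c := by
    have := mul_le_mul_of_nonneg_left h3 he
    linarith
  have hcross : (n * c) * (n * θ) ≤ 1 / 2 * (n * θ) := mul_le_mul_of_nonneg_right h2 hnθ0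
  have hsq : (n * θ) * (n * θ) ≤ 1 / 2 * (n * θ) := mul_le_mul_of_nonneg_right hnθ hnθ0
  have hcross' : e * ((n * c) * (n * θ)) ≤ 1 / 2 * (n * θ) :=
    (mul_le_mul_of_nonneg_left hcross he).trans (mul_le_of_le_one_left (by linarith) he1)
  have hbern := one_add_mul_le_pow (a := e * (c + n * c ^ 2) + 3 * θ)
    (by nlinarith [mul_nonneg he hcc]) n
  rw [← add_assoc] at hbern
  calc e * (1 + c + θ) ^ n + (1 - e) * (1 + θ) ^ n
      ≤ e * (1 + n * (c + θ) + (n * (c + θ)) ^ 2) + (1 - e) * (1 + n * θ + (n * θ) ^ 2) := by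
        refine add_le_add (mul_le_mul_of_nonneg_left ?_ he)
          (mul_le_mul_of_nonneg_left hB (by linarith))
        rw [add_assoc]; exact hA
    _ = 1 + n * (e * (c + n * c ^ 2) + θ) + 2 * (e * ((n * c) * (n * θ))) + (n * θ) * (n * θ) := by
        ring
    _ ≤ 1 + n * (e * (c + n * c ^ 2) + 3 * θ) := by linarith
    _ ≤ (1 + e * (c + n * c ^ 2) + 3 * θ) ^ n := hbern

open MvPolynomial in
/-- Few tuples of directions span flats whose intersection with `S` deviates from its expected
size, in the direction given by the sign of `c`. -/
theorem card_deviating_directions_le {F : Type*} [Field F] [Fintype F] [DecidableEq F] {n k : ℕ}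
    (hn : 1 ≤ n) (S : Finset (Fin n → F)) {c κ : ℝ} (hc : n * |c| ≤ 1 / 2) (hκ : 0 < κ)
    (B : Finset (Fin k → Fin n → F))
    (hB : ∀ b ∈ B, ∃ a : Fin n → F,
      (S.card : ℝ) / (Fintype.card F : ℝ) ^ n * (c + n * c ^ 2) + κ ≤
        c * (Finset.univ.filter fun s : Fin k → F => a + ∑ l, s l • b l ∈ S).card /
          (Fintype.card F : ℝ) ^ k) :
    (Fintype.card F : ℝ) ^ k * κ * B.card ≤
      8 * Fintype.card F * ((Fintype.card F : ℝ) ^ k) ^ n := by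
  set q : ℝ := (Fintype.card F : ℝ) with hq
  have hq1 : 1 ≤ q := by
    rw [hq]; exact_mod_cast Fintype.card_pos
  set e : ℝ := (S.card : ℝ) / q ^ n with he
  have he0 : 0 ≤ e := by positivity
  have hSle : (S.card : ℝ) ≤ q ^ n := by
    have := S.card_le_univ
    rw [Fintype.card_fun, Fintype.card_fin] at this
    rw [hq]; exact_mod_cast this
  have he1 : e ≤ 1 := div_le_one_of_le₀ hSle (by positivity)
  have hn' : (1 : ℝ) ≤ n := by exact_mod_cast hn
  have hc1 : |c| ≤ 1 / 2 := le_trans (le_mul_of_one_le_left (abs_nonneg c) hn') hc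
  obtain ⟨hc2, hc3⟩ := abs_le.1 hc1
  have hncc : n * c ^ 2 ≤ 1 / 4 := by
    rw [← sq_abs]
    nlinarith [abs_nonneg c]
  have hncc0 : 0 ≤ n * c ^ 2 := by positivity
  -- `m` is the multiplicity scale. Rounding up and the shift `n - 1` of the interpolation cost at
  -- most `n = m θ`, so `m` is taken large enough that `n θ ≤ 1/16` and `16 θ ≤ κ`.
  obtain ⟨m, hm⟩ := exists_nat_gt (16 * n ^ 2 + 16 * n / κ)
  have hmpos : (0 : ℝ) < m := lt_trans (by positivity) hm
  have hm1 : 16 * (n : ℝ) ^ 2 ≤ m := by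
    have : 0 ≤ 16 * n / κ := by positivity
    linarith
  have hm2 : 16 * n ≤ m * κ := by
    rw [← div_le_iff₀ hκ]
    have : (0 : ℝ) ≤ 16 * (n : ℝ) ^ 2 := by positivity
    linarith
  set θ : ℝ := n / m with hθ
  have hθ0 : 0 ≤ θ := by positivity
  have hmθ : m * θ = n := by rw [hθ]; field_simp
  have hnθ : n * θ ≤ 1 / 16 := by
    rw [hθ, ← mul_div_assoc, div_le_iff₀ hmpos]; nlinarith
  have hθ16 : θ ≤ 1 / 16 := le_trans (le_mul_of_one_le_left hθ0 hn') hnθ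
  have hθκ : 16 * θ ≤ κ := by
    rw [hθ, ← mul_div_assoc, div_le_iff₀ hmpos]; linarith
  set D : ℝ := 1 + e * (c + n * c ^ 2) + 3 * θ with hD
  have hD0 : 0 ≤ D := by
    have := mul_le_mul_of_nonneg_left hc2 he0
    have := mul_nonneg he0 hncc0
    rw [hD, mul_add]; linarith
  have hD1 : D + θ ≤ 2 := by
    have : e * (c + n * c ^ 2) ≤ 1 * (3 / 4) := by
      refine (mul_le_mul_of_nonneg_left (by linarith : c + n * c ^ 2 ≤ 3 / 4) he0).trans ?_
      linarith
    linarith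
  let w : (Fin n → F) → ℝ := fun y => 1 + c * if y ∈ S then 1 else 0
  have hw : ∀ y, 0 ≤ w y := by
    intro y; simp only [w]; split_ifs <;> linarith
  let M : (Fin n → F) → ℕ := fun y => ⌈m * w y⌉₊
  let d : ℕ := ⌈m * q * D⌉₊
  have hd : (d : ℝ) ≤ m * q * (D + θ) := by
    have h1 : (d : ℝ) < m * q * D + 1 := Nat.ceil_lt_add_one (by positivity)
    have h2 : 1 ≤ m * q * θ := by
      calc (1 : ℝ) ≤ q * n := by nlinarith
        _ = m * q * θ := by rw [← hmθ]; ring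
    linarith
  have hinterp : ∑ y, (M y + (n - 1)) ^ n ≤ d ^ n := by
    have hreal : ∑ y, ((M y : ℝ) + (n - 1 : ℕ)) ^ n ≤ (d : ℝ) ^ n := by
      calc ∑ y, ((M y : ℝ) + (n - 1 : ℕ)) ^ n ≤ ∑ y, (m * (w y + θ)) ^ n := by
            refine Finset.sum_le_sum fun y _ => pow_le_pow_left₀ (by positivity) ?_ _
            have h1 : (M y : ℝ) < m * w y + 1 :=
              Nat.ceil_lt_add_one (mul_nonneg hmpos.le (hw y))
            rw [mul_add, hmθ, Nat.cast_sub hn, Nat.cast_one]; linarith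
        _ = ∑ y, ((m * (1 + θ)) ^ n +
              if y ∈ S then (m * (1 + c + θ)) ^ n - (m * (1 + θ)) ^ n else 0) := by
            refine Finset.sum_congr rfl fun y _ => ?_
            simp only [w]; split_ifs <;> ring_nf
        _ = m ^ n * q ^ n * (e * (1 + c + θ) ^ n + (1 - e) * (1 + θ) ^ n) := by
            rw [Finset.sum_add_distrib, Finset.sum_const, Finset.sum_ite_mem, Finset.univ_inter,
              Finset.sum_const, Finset.card_univ, Fintype.card_fun, Fintype.card_fin]
            have : (S.card : ℝ) = e * q ^ n := by rw [he]; field_simp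
            simp only [nsmul_eq_mul, this, mul_pow]
            push_cast
            rw [← hq]
            ring
        _ ≤ m ^ n * q ^ n * D ^ n := by
            gcongr
            exact weighted_pow_mean_le he0 he1 hc hθ0 (by linarith) hn
        _ = (m * q * D) ^ n := by rw [mul_pow, mul_pow]
        _ ≤ (d : ℝ) ^ n := by gcongr; exact Nat.le_ceil _
    exact_mod_cast hreal
  obtain ⟨P, hP, hPd, hM⟩ := exists_vanishesToOrder hn d M hinterp
  have hPd' : (P.totalDegree : ℝ) ≤ m * q * (D + θ) := le_trans (by exact_mod_cast hPd) hd
  -- Half of the surplus `κ` becomes order of vanishing; the other half absorbs the error `4 θ`.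
  let r : ℕ := ⌊m * κ / 2⌋₊
  have hr1 : (r : ℝ) ≤ m * κ / 2 := Nat.floor_le (by positivity)
  have hr2 : m * κ / 4 ≤ r := by
    have : m * κ / 2 < r + 1 := Nat.lt_floor_add_one _
    linarith
  have hmain := card_directions_le hP hM r B (by
    intro b hb
    obtain ⟨a, ha⟩ := hB b hb
    refine ⟨a, ?_⟩
    set X := (Finset.univ.filter fun s : Fin k → F => a + ∑ l, s l • b l ∈ S).card with hX
    have hsum : m * (q ^ k + c * X) ≤ ∑ s : Fin k → F, (M (a + ∑ l, s l • b l) : ℝ) := by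
      calc m * (q ^ k + c * X) = ∑ s : Fin k → F, m * w (a + ∑ l, s l • b l) := by
            simp only [w]
            rw [← Finset.mul_sum, Finset.sum_add_distrib, ← Finset.mul_sum, Finset.sum_boole, ← hX]
            simp [hq]
        _ ≤ _ := Finset.sum_le_sum fun s _ => Nat.le_ceil _
    have hlow : D - 3 * θ + κ ≤ 1 + c * X / q ^ k := by rw [hD]; linarith
    have hfin : (P.totalDegree : ℝ) * q ^ k + r * q ^ (k + 1) <
        q * ∑ s : Fin k → F, (M (a + ∑ l, s l • b l) : ℝ) := by
      calc (P.totalDegree : ℝ) * q ^ k + r * q ^ (k + 1)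
          ≤ m * q * (D + θ) * q ^ k + m * κ / 2 * q ^ (k + 1) := by gcongr
        _ = q * (m * (q ^ k * (D + θ + κ / 2))) := by ring
        _ < q * (m * (q ^ k * (1 + c * X / q ^ k))) := by
            have : (0 : ℝ) < θ := by positivity
            have : D + θ + κ / 2 < 1 + c * X / q ^ k := by linarith
            gcongr ?_ * (?_ * (?_ * ?_))
        _ = q * (m * (q ^ k + c * X)) := by field_simp
        _ ≤ _ := by gcongr
    rw [hq] at hfin
    exact_mod_cast hfin)
  have hmain' : q ^ k * (r * B.card) ≤ P.totalDegree * (q ^ k) ^ n := by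
    rw [hq]; exact_mod_cast hmain
  have h1 : q ^ k * (m * κ / 4 * B.card) ≤ m * q * 2 * (q ^ k) ^ n := by
    calc q ^ k * (m * κ / 4 * B.card) ≤ q ^ k * (r * B.card) := by gcongr
      _ ≤ P.totalDegree * (q ^ k) ^ n := hmain'
      _ ≤ m * q * 2 * (q ^ k) ^ n := by
        gcongr
        exact hPd'.trans (by gcongr)
  refine le_of_mul_le_mul_left (a := (m : ℝ)) ?_ hmpos
  linarith

/-! ### Counting tuples, bases and subspaces. -/

section count
variable {F : Type*} [Field F] [Fintype F]

theorem card_basis_tuples {V : Type*} [AddCommGroup V] [Module F V] [Finite V] {k : ℕ}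
    (A : Submodule F V) (hA : Module.finrank F A = k) :
    Nat.card {b : Fin k → V // LinearIndependent F b ∧ Submodule.span F (Set.range b) = A} =
      ∏ i : Fin k, (Fintype.card F ^ k - Fintype.card F ^ i.val) := by
  have hk := card_linearIndependent (K := F) (V := A) (k := k) hA.ge
  rw [hA] at hk
  rw [← hk]
  refine Nat.card_congr
    { toFun := fun b => ⟨fun i => ⟨b.1 i, ?_⟩, ?_⟩
      invFun := fun b => ⟨fun i => b.1 i, ?_, ?_⟩
      left_inv := fun b => rfl
      right_inv := fun b => rfl }
  · exact b.2.2.le (Submodule.subset_span ⟨i, rfl⟩)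
  · exact LinearIndependent.of_comp A.subtype b.2.1
  · exact b.2.map' A.subtype A.ker_subtype
  · have hli : LinearIndependent F fun i => (b.1 i : V) := b.2.map' A.subtype A.ker_subtype
    refine Submodule.eq_of_le_of_finrank_eq ?_ ?_
    · rw [Submodule.span_le]
      rintro _ ⟨i, rfl⟩
      exact (b.1 i).2
    · rw [finrank_span_eq_card hli, Fintype.card_fin, hA]

/-- Each `k`-dimensional subspace is spanned by the same number of `k`-tuples. -/
theorem card_tuples_spanning {n k : ℕ} (𝓑 : Set (Submodule F (Fin n → F)))
    (h𝓑 : 𝓑 ⊆ linearSubspaces F n k) :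
    Nat.card {b : Fin k → Fin n → F // LinearIndependent F b ∧
      Submodule.span F (Set.range b) ∈ 𝓑} =
      𝓑.ncard * ∏ i : Fin k, (Fintype.card F ^ k - Fintype.card F ^ i.val) := by
  classical
  have e : {b : Fin k → Fin n → F // LinearIndependent F b ∧
      Submodule.span F (Set.range b) ∈ 𝓑} ≃ Σ A : 𝓑, {b : Fin k → Fin n → F //
        LinearIndependent F b ∧ Submodule.span F (Set.range b) = A} :=
    { toFun := fun b => ⟨⟨_, b.2.2⟩, b.1, b.2.1, rfl⟩
      invFun := fun p => ⟨p.2.1, p.2.2.1, by rw [p.2.2.2]; exact p.1.2⟩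
      left_inv := fun b => rfl
      right_inv := by
        rintro ⟨⟨A, hA⟩, b, hb, h⟩
        change Submodule.span F (Set.range b) = A at h
        subst h
        rfl }
  have : Fintype 𝓑 := Fintype.ofFinite _
  rw [Nat.card_congr e, Nat.card_sigma, Finset.sum_congr rfl fun A _ =>
    card_basis_tuples A.1 (h𝓑 A.2), Finset.sum_const, Finset.card_univ, smul_eq_mul,
    ← Nat.card_eq_fintype_card, Nat.card_coe_set_eq]

/-- The induction step is `(1 - x/2)(1 - x) ≥ 1 - 3x/2 ≥ 1 - qx/2`, which is where `q ≥ 3` enters.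
For `k ≤ n` the factor is at least `1/2`. -/
theorem pow_mul_pow_le_two_mul_prod {q : ℝ} (hq : 3 ≤ q) (n : ℕ) : ∀ k ≤ n,
    (q ^ n) ^ k * (1 - q ^ k / (2 * q ^ n)) ≤ ∏ i : Fin k, (q ^ n - q ^ i.val)
  | 0, _ => by
    have : 0 ≤ 1 / (2 * q ^ n) := by positivity
    simp only [pow_zero, one_mul, Finset.univ_eq_empty, Finset.prod_empty]
    linarith
  | k + 1, hk => by
    have ih := pow_mul_pow_le_two_mul_prod hq n k (by omega)
    have hkn : q ^ k ≤ q ^ n := pow_le_pow_right₀ (by linarith) (by omega)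
    have hQ : 0 < q ^ n := by positivity
    have hK : 0 < q ^ k := by positivity
    rw [Fin.prod_univ_castSucc]
    refine le_trans ?_ (mul_le_mul_of_nonneg_right ih (by simpa using hkn))
    set x := q ^ k / q ^ n with hx
    have hx0 : 0 ≤ x := by positivity
    have h1 : q ^ k = x * q ^ n := by rw [hx]; field_simp
    have h2 : q ^ k / (2 * q ^ n) = x / 2 := by rw [hx]; field_simp
    have h3 : q ^ (k + 1) / (2 * q ^ n) = q * x / 2 := by rw [hx, pow_succ]; field_simp
    simp only [Fin.val_last]
    rw [h2, h3, h1]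
    have : (1 - q * x / 2) ≤ (1 - x / 2) * (1 - x) := by nlinarith
    calc (q ^ n) ^ (k + 1) * (1 - q * x / 2) ≤ (q ^ n) ^ (k + 1) * ((1 - x / 2) * (1 - x)) := by
          gcongr
      _ = _ := by rw [pow_succ]; ring

theorem pow_le_two_mul_card_linearIndependent (hq : 3 ≤ Fintype.card F) {n k : ℕ} (hk : k ≤ n) :
    ((Fintype.card F : ℝ) ^ k) ^ n ≤
      2 * Nat.card {b : Fin k → Fin n → F // LinearIndependent F b} := by
  have hq' : (3 : ℝ) ≤ Fintype.card F := by exact_mod_cast hq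
  have hkn : (Fintype.card F : ℝ) ^ k ≤ (Fintype.card F : ℝ) ^ n :=
    pow_le_pow_right₀ (by linarith) hk
  have h := pow_mul_pow_le_two_mul_prod hq' n k hk
  have hcast : (Nat.card {b : Fin k → Fin n → F // LinearIndependent F b} : ℝ) =
      ∏ i : Fin k, ((Fintype.card F : ℝ) ^ n - (Fintype.card F : ℝ) ^ i.val) := by
    rw [card_linearIndependent (by simpa using hk), Module.finrank_fin_fun, Nat.cast_prod]
    refine Finset.prod_congr rfl fun i _ => ?_
    rw [Nat.cast_sub (Nat.pow_le_pow_right (by omega) (by omega))]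
    push_cast; rfl
  rw [hcast]
  have hhalf : (1 : ℝ) / 2 ≤ 1 - (Fintype.card F : ℝ) ^ k / (2 * (Fintype.card F : ℝ) ^ n) := by
    have : (Fintype.card F : ℝ) ^ k / (2 * (Fintype.card F : ℝ) ^ n) ≤ 1 / 2 := by
      rw [div_le_iff₀ (by positivity)]; linarith
    linarith
  have h2 : (((Fintype.card F : ℝ) ^ n) ^ k) * (1 / 2) ≤ _ :=
    (mul_le_mul_of_nonneg_left hhalf (by positivity)).trans h
  rw [← pow_mul, mul_comm k n, pow_mul]
  linarith

end count

/-! ### From deviating tuples to deviating subspaces. -/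

section deviating
variable {F : Type*} [Field F] [Fintype F] {n k : ℕ}

theorem ncard_flat_inter (S : Finset (Fin n → F)) [DecidableEq F] (a : Fin n → F)
    {b : Fin k → Fin n → F} (hb : LinearIndependent F b) :
    ((AffineSubspace.mk' a (Submodule.span F (Set.range b)) : Set (Fin n → F)) ∩ S).ncard =
      (Finset.univ.filter fun s : Fin k → F => a + ∑ l, s l • b l ∈ S).card := by
  have hinj : Function.Injective fun s : Fin k → F => a + ∑ l, s l • b l := fun s t h =>
    (linearIndependent_iff_injective_fintypeLinearCombination.1 hb)
      (by simpa [Fintype.linearCombination_apply] using h)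
  rw [← Finset.card_image_of_injective _ hinj, ← Set.ncard_coe_finset]
  congr 1
  ext y
  simp only [Set.mem_inter_iff, SetLike.mem_coe, AffineSubspace.mem_mk', vsub_eq_sub,
    Submodule.mem_span_range_iff_exists_fun, Finset.coe_image, Finset.coe_filter,
    Finset.mem_univ, true_and, Set.mem_image, Set.mem_ofPred_eq]
  constructor
  · rintro ⟨⟨s, hs⟩, hy⟩
    have : a + ∑ l, s l • b l = y := by rw [hs]; abel
    exact ⟨s, by rwa [this], this⟩
  · rintro ⟨s, hs, rfl⟩
    exact ⟨⟨s, by abel⟩, hs⟩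

/-- Every subspace has the same number `γ` of bases, so `γ` cancels; at least half of all tuples are
independent, which turns `8` into `16`. -/
theorem ncard_deviating_subspaces_le (hn : 1 ≤ n) (hk : k ≤ n) (hq : 3 ≤ Fintype.card F)
    (S : Finset (Fin n → F)) {c κ : ℝ} (hc : n * |c| ≤ 1 / 2) (hκ : 0 < κ)
    (𝓑 : Set (Submodule F (Fin n → F))) (h𝓑 : 𝓑 ⊆ linearSubspaces F n k)
    (h : ∀ A ∈ 𝓑, ∃ a : Fin n → F,
      (S.card : ℝ) / (Fintype.card F : ℝ) ^ n * (c + n * c ^ 2) + κ ≤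
        c * ((AffineSubspace.mk' a A : Set (Fin n → F)) ∩ S).ncard / (Fintype.card F : ℝ) ^ k) :
    (Fintype.card F : ℝ) ^ k * κ * 𝓑.ncard ≤
      16 * Fintype.card F * (linearSubspaces F n k).ncard := by
  classical
  set γ := ∏ i : Fin k, (Fintype.card F ^ k - Fintype.card F ^ i.val)
  let B : Finset (Fin k → Fin n → F) := Finset.univ.filter fun b =>
    LinearIndependent F b ∧ Submodule.span F (Set.range b) ∈ 𝓑
  have hB : B.card = 𝓑.ncard * γ := by
    rw [← card_tuples_spanning 𝓑 h𝓑, Nat.card_eq_fintype_card, Fintype.card_subtype]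
  have hall : Nat.card {b : Fin k → Fin n → F // LinearIndependent F b} =
      (linearSubspaces F n k).ncard * γ := by
    rw [← card_tuples_spanning _ subset_rfl]
    refine Nat.card_congr (Equiv.subtypeEquivRight fun b => ⟨fun hb => ⟨hb, ?_⟩, fun hb => hb.1⟩)
    change Module.finrank F _ = k
    rw [finrank_span_eq_card hb, Fintype.card_fin]
  have h1 := card_deviating_directions_le hn S hc hκ B (by
    intro b hb
    obtain ⟨hli, hspan⟩ := (Finset.mem_filter.1 hb).2
    obtain ⟨a, ha⟩ := h _ hspan
    rw [ncard_flat_inter S a hli] at ha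
    exact ⟨a, ha⟩)
  have h2 := pow_le_two_mul_card_linearIndependent hq hk
  rw [hall] at h2
  rw [hB] at h1
  push_cast at h1 h2
  have hq0 : (0 : ℝ) < Fintype.card F := by exact_mod_cast Fintype.card_pos
  have hγ : (0 : ℝ) < γ := by
    refine lt_of_le_of_ne (Nat.cast_nonneg _) fun h0 => ?_
    rw [← h0] at h2
    have : (0 : ℝ) < ((Fintype.card F : ℝ) ^ k) ^ n := by positivity
    linarith
  refine le_of_mul_le_mul_right ?_ hγ
  calc (Fintype.card F : ℝ) ^ k * κ * 𝓑.ncard * γ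
      = (Fintype.card F : ℝ) ^ k * κ * (𝓑.ncard * γ) := by ring
    _ ≤ 8 * Fintype.card F * ((Fintype.card F : ℝ) ^ k) ^ n := h1
    _ ≤ 8 * Fintype.card F * (2 * ((linearSubspaces F n k).ncard * γ)) := by gcongr
    _ = _ := by ring

theorem expectedInter_eq (S : Set (Fin n → F)) :
    expectedInter k S = S.ncard / (Fintype.card F : ℝ) ^ n * (Fintype.card F : ℝ) ^ k := by
  have hq0 : (Fintype.card F : ℝ) ≠ 0 := by exact_mod_cast Fintype.card_ne_zero
  rw [expectedInter, zpow_sub₀ hq0, zpow_natCast, zpow_natCast]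
  field_simp

/-- With `c = ± c₀` for a suitable `c₀ > 0`, the subspaces having a translate that deviates from
the expected intersection in the direction given by the sign of `c` are a small fraction. -/
theorem ncard_signed_deviating_le (hn : 1 ≤ n) (hk : k ≤ n) (hq : 3 ≤ Fintype.card F)
    (S : Set (Fin n → F)) {τ δ σ : ℝ} (hτ : 0 < τ) (hσ : σ = 1 ∨ σ = -1)
    (hE : 128 * n * Fintype.card F ≤ expectedInter k S * (min τ 1 * τ * δ))
    (hE0 : 0 < expectedInter k S) :
    ({A ∈ linearSubspaces F n k | ∃ a : Fin n → F, τ * expectedInter k S <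
      σ * (((AffineSubspace.mk' a A : Set (Fin n → F)) ∩ S).ncard - expectedInter k S)}.ncard : ℝ)
      ≤ δ / 2 * (linearSubspaces F n k).ncard := by
  classical
  have hS : ((S.toFinset : Finset (Fin n → F)) : Set (Fin n → F)) = S := Set.coe_toFinset S
  have hn' : (1 : ℝ) ≤ n := by exact_mod_cast hn
  have hq0 : (0 : ℝ) < Fintype.card F := by exact_mod_cast Fintype.card_pos
  have hσ2 : σ ^ 2 = 1 := by rcases hσ with rfl | rfl <;> norm_num
  have hσa : |σ| = 1 := by rcases hσ with rfl | rfl <;> norm_num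
  set E := expectedInter k S with hEdef
  have hEeq : S.ncard / (Fintype.card F : ℝ) ^ n = E / (Fintype.card F : ℝ) ^ k := by
    rw [hEdef, expectedInter_eq]; field_simp
  set μ := min τ 1
  have hμ0 : 0 < μ := lt_min hτ one_pos
  have hμτ : μ ≤ τ := min_le_left _ _
  have hμ1 : μ ≤ 1 := min_le_right _ _
  -- The second-order loss `n c₀² = μ c₀ / 2` uses up at most half of the gain `c₀ τ`; the other
  -- half is `κ`. Capping `τ` at `1` ensures `n c₀ ≤ 1/2`.
  set c₀ : ℝ := μ / (2 * n) with hc₀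
  have hc₀0 : 0 < c₀ := by positivity
  have hnc : n * c₀ = μ / 2 := by rw [hc₀]; field_simp
  set κ : ℝ := c₀ * τ / 2 * (E / (Fintype.card F : ℝ) ^ k) with hκ
  have hκ0 : 0 < κ := by positivity
  have main := ncard_deviating_subspaces_le hn hk hq S.toFinset (c := σ * c₀) (κ := κ)
    (by rw [abs_mul, hσa, one_mul, abs_of_pos hc₀0, hnc]; linarith) hκ0
    {A ∈ linearSubspaces F n k | ∃ a : Fin n → F, τ * E <
      σ * (((AffineSubspace.mk' a A : Set (Fin n → F)) ∩ S).ncard - E)}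
    (Set.sep_subset _ _) (by
      rintro A ⟨_, a, ha⟩
      refine ⟨a, ?_⟩
      rw [← Set.ncard_eq_toFinset_card', hEeq, hS, hκ]
      set X : ℝ := (((AffineSubspace.mk' a A : Set (Fin n → F)) ∩ S).ncard : ℝ)
      have h1 : n * (σ * c₀) ^ 2 = μ / 2 * c₀ := by rw [mul_pow, hσ2, ← hnc]; ring
      rw [h1]
      have h2 : E * (σ * c₀ + μ / 2 * c₀) + c₀ * τ / 2 * E ≤ σ * c₀ * X := by
        have h3 : μ * (c₀ * E) ≤ τ * (c₀ * E) := by gcongr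
        have h4 := mul_le_mul_of_nonneg_left ha.le hc₀0.le
        linarith
      calc E / (Fintype.card F : ℝ) ^ k * (σ * c₀ + μ / 2 * c₀) +
            c₀ * τ / 2 * (E / (Fintype.card F : ℝ) ^ k)
          = (E * (σ * c₀ + μ / 2 * c₀) + c₀ * τ / 2 * E) / (Fintype.card F : ℝ) ^ k := by ring
        _ ≤ _ := by gcongr)
  have hκq : (Fintype.card F : ℝ) ^ k * κ = μ * τ * E / (4 * n) := by
    rw [hκ, hc₀]; field_simp; norm_num
  rw [hκq] at main
  have hpos : 0 < μ * τ * E / (4 * n) := by positivity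
  refine le_of_mul_le_mul_left (main.trans ?_) hpos
  -- Source of the constant: `16 · 4 · 2 = 128`.
  have hcoef : 16 * Fintype.card F ≤ μ * τ * E / (4 * n) * (δ / 2) := by
    rw [div_mul_eq_mul_div, le_div_iff₀ (by positivity)]
    linarith
  rw [← mul_assoc]
  gcongr

end deviating

/-! ### Conclusion: parameters and the union bound over both signs. -/

theorem mainTheorem8 :
    ∀ η : ℝ, 0 < η → η ≤ 1 →
      ∃ C : ℝ, 0 < C ∧
        ∀ (F : Type*) [Field F] [Fintype F] (n : ℕ), 5 ≤ n →
          ∀ S : Set (Fin n → F), Fintype.card F ^ 4 < S.ncard →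
            ∀ τ δ : ℝ, 0 < τ → 0 < δ → δ < 1 →
              C * max ((n : ℝ) * (1 + τ) / (τ * δ) ^ 2) (n : ℝ) ≤ (Fintype.card F : ℝ) ^ η →
              ∀ k : ℕ,
                (Fintype.card F : ℝ) ^ ((n : ℝ) + 2 + η) <
                  (Fintype.card F : ℝ) ^ k * (S.ncard : ℝ) →
                (1 - δ) * ((linearSubspaces F n k).ncard : ℝ) ≤
                  ({A ∈ linearSubspaces F n k | IsShiftBalanced τ S A}.ncard : ℝ) := by
  intro η hη0 hη1
  refine ⟨128, by norm_num, ?_⟩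
  intro F _ _ n hn S _ τ δ hτ hδ hδ1 hC k hk
  rcases lt_or_ge n k with hnk | hkn
  · have : linearSubspaces F n k = ∅ := by
      refine Set.eq_empty_of_forall_notMem fun A hA => ?_
      have h1 : Module.finrank F A = k := hA
      have h2 := A.finrank_le
      rw [h1, Module.finrank_fin_fun] at h2
      omega
    simp [this]
  have hn' : (5 : ℝ) ≤ n := by exact_mod_cast hn
  have hq1 : (1 : ℝ) < Fintype.card F := by exact_mod_cast Fintype.one_lt_card
  set q : ℝ := (Fintype.card F : ℝ) with hqdef
  have hq0 : 0 < q := by linarith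
  have hqη : q ^ η ≤ q := by
    simpa using Real.rpow_le_rpow_of_exponent_le hq1.le hη1
  have hCn : 128 * (n : ℝ) ≤ q ^ η := le_trans (by gcongr; exact le_max_right _ _) hC
  have hCτ : 128 * ((n : ℝ) * (1 + τ) / (τ * δ) ^ 2) ≤ q ^ η :=
    le_trans (by gcongr; exact le_max_left _ _) hC
  have hq3 : 3 ≤ Fintype.card F := by
    have : (3 : ℝ) ≤ q := by linarith
    rw [hqdef] at this
    exact_mod_cast this
  -- The hypothesis on `k` says that `E_k(S)` exceeds `q^(2+η)`; it is weakened here to `q^(1+η)`.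
  have hE : q * q ^ η ≤ expectedInter k S := by
    rw [expectedInter_eq, ← hqdef, div_mul_eq_mul_div, le_div_iff₀ (by positivity)]
    rw [Real.rpow_add hq0, Real.rpow_add hq0, Real.rpow_natCast] at hk
    have h2 : q ≤ q ^ (2 : ℝ) := by
      have : q ^ (2 : ℝ) = q * q := by rw [Real.rpow_two, sq]
      rw [this]
      exact le_mul_of_one_le_left hq0.le hq1.le
    calc q * q ^ η * q ^ n = q ^ n * q * q ^ η := by ring
      _ ≤ q ^ n * q ^ (2 : ℝ) * q ^ η := by gcongr
      _ ≤ S.ncard * q ^ k := by linarith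
  have hE0 : 0 < expectedInter k S := lt_of_lt_of_le (by positivity) hE
  have hEmain : 128 * n * q ≤ expectedInter k S * (min τ 1 * τ * δ) := by
    have hμ0 : 0 < min τ 1 := lt_min hτ one_pos
    -- This inequality is how the factor `1 + τ` of the hypothesis pays for the cap `min τ 1`.
    have hμ : τ ≤ (1 + τ) * min τ 1 := by
      rcases min_choice τ 1 with h | h <;> rw [h] <;> nlinarith
    calc 128 * n * q ≤ 128 * n * q * ((1 + τ) * min τ 1 / (τ * δ)) := by
          refine le_mul_of_one_le_right (by positivity) ?_
          rw [one_le_div (by positivity)]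
          nlinarith
      _ = q * (128 * ((n : ℝ) * (1 + τ) / (τ * δ) ^ 2)) * (min τ 1 * τ * δ) := by
          field_simp
      _ ≤ q * q ^ η * (min τ 1 * τ * δ) := by gcongr
      _ ≤ _ := by gcongr
  have hplus := ncard_signed_deviating_le (by omega) hkn hq3 S hτ (Or.inl rfl) hEmain hE0
  have hminus := ncard_signed_deviating_le (by omega) hkn hq3 S hτ (Or.inr rfl) hEmain hE0
  set good := {A ∈ linearSubspaces F n k | IsShiftBalanced τ S A} with hgood
  set plus := {A ∈ linearSubspaces F n k | ∃ a : Fin n → F, τ * expectedInter k S <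
    1 * (((AffineSubspace.mk' a A : Set (Fin n → F)) ∩ S).ncard - expectedInter k S)}
  set minus := {A ∈ linearSubspaces F n k | ∃ a : Fin n → F, τ * expectedInter k S <
    -1 * (((AffineSubspace.mk' a A : Set (Fin n → F)) ∩ S).ncard - expectedInter k S)}
  have hcover : linearSubspaces F n k ⊆ good ∪ (plus ∪ minus) := by
    intro A hA
    by_cases hb : IsShiftBalanced τ S A
    · exact Or.inl ⟨hA, hb⟩
    · right
      obtain ⟨a, ha⟩ := not_forall.1 hb
      have hAk : Module.finrank F A = k := hA
      rw [IsBalanced, AffineSubspace.direction_mk', hAk, not_le, lt_abs] at ha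
      rcases ha with ha | ha
      · exact Or.inl ⟨hA, a, by rwa [one_mul]⟩
      · exact Or.inr ⟨hA, a, by rwa [neg_one_mul]⟩
  have hcard : ((linearSubspaces F n k).ncard : ℝ) ≤ good.ncard + (plus.ncard + minus.ncard) := by
    exact_mod_cast (Set.ncard_le_ncard hcover (Set.toFinite _)).trans
      ((Set.ncard_union_le _ _).trans (Nat.add_le_add_left (Set.ncard_union_le _ _) _))
  linarith
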